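/- For positive integers $k_1,\dots,k_r$ with $k_r\ge 2$, let $$T(k_1,\dots,k_r)=2^{r}\sum_{\substack{0<m_1<\cdots<m_r\\ m_j\equiv j\ (\mathrm{mod}\ 2)}}\frac{1}{m_1^{k_1}\cdots m_r^{k_r}}$$ be the multiple $T$-value, and let $\{1\}^{a}$ denote $a$ repetitions of $1$. Let $E_j(t)$ be the Euler polynomials, defined by $$\frac{2e^{tX}}{e^{X}+1}=\sum_{j=0}^{\infty}E_j(t)\frac{X^j}{j!}.$$ Then, for all integers $n\ge 0$ and $k\ge 1$, the series and integrals below converge absolutely, and $$T(\{1\}^{2n},2k)=\frac{\pi^{2k-2}}{(2k-2)!}\sum_{m=0}^{n}\frac{(-1)^{k+m-1}(\pi/2)^{2m+1}}{(2m+1)!\,(2n-2m)!}\int_{0}^{\pi/2}E_{2k-2}\!\left(\frac{\theta}{\pi}\right)\left(\log\tan\frac{\theta}{2}\right)^{2n-2m}d\theta$$ and $$T(\{1\}^{2n},2k+1)=\frac{\pi^{2k-1}}{(2k-1)!}\sum_{m=0}^{n}\frac{(-1)^{k+m-1}(\pi/2)^{2m}}{(2m)!\,(2n+1-2m)!}\int_{0}^{\pi/2}E_{2k-1}\!\left(\frac{\theta}{\pi}\right)\left(\log\tan\frac{\theta}{2}\right)^{2n+1-2m}d\theta.$$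 -/

import Mathlib

open scoped Nat

noncomputable section

/-- The summation domain of a multiple `T`-value of depth `n`: integers `0 < m₁ < ⋯ < mₙ` with
`mⱼ ≡ j mod 2`. Positions are counted from `0`, so that `m j` stands for `m_{j+1}`. -/
def MultipleTIndex (n : ℕ) : Type :=
  {m : Fin n → ℕ // StrictMono m ∧ ∀ j : Fin n, 0 < m j ∧ m j ≡ (j : ℕ) + 1 [MOD 2]}

/-- The summand `1 / (m₁ ^ k₁ ⋯ mₙ ^ kₙ)`. -/
def multipleTTerm {n : ℕ} (k : Fin n → ℕ) (m : MultipleTIndex n) : ℝ :=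
  1 / ∏ j : Fin n, (m.1 j : ℝ) ^ k j

/-- The multiple `T`-value `T(k₁, …, kₙ)`. -/
def multipleT {n : ℕ} (k : Fin n → ℕ) : ℝ :=
  2 ^ n * ∑' m : MultipleTIndex n, multipleTTerm k m

/-- The index `({1}^a, b)`, of depth `a + 1`. -/
def onesThen (a b : ℕ) : Fin (a + 1) → ℕ :=
  Fin.snoc (α := fun _ => ℕ) (fun _ : Fin a => 1) b

/-- The `j`-th Euler polynomial: `j!` times the coefficient of `Y ^ j` in the power series
`2 e ^ (X Y) / (e ^ Y + 1)` in `Y`, whose coefficients are polynomials in `X`. -/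
def eulerPoly (j : ℕ) : Polynomial ℚ :=
  (j ! : Polynomial ℚ) * PowerSeries.coeff j
    (2 * PowerSeries.rescale Polynomial.X (PowerSeries.exp (Polynomial ℚ)) *
      PowerSeries.map Polynomial.C (PowerSeries.exp ℚ + 1)⁻¹)

/-- The integrand `E_j(θ / π) (log tan (θ / 2)) ^ l`. -/
def eulerLogTan (j l : ℕ) (θ : ℝ) : ℝ :=
  Polynomial.aeval (θ / Real.pi) (eulerPoly j) * Real.log (Real.tan (θ / 2)) ^ l

end

/-! ### Euler polynomials: special values and trigonometric moments on `[0, π/2]`. -/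

section EulerPolynomials

open Polynomial

/-! Let `f(z) = log (1 + z) - log (1 - z)`. Since `f' = 2 / (1 - z²)`, iterated integration shows
that the coefficient of `z ^ m` in `f ^ (a + 1)` is, up to `(a + 1)! 2 ^ (a + 1)`, the truncated sum
behind `T({1}^a, ·)` with last entry `m` (`coeff_logRatioSeries_pow`). On the unit circle `f(e^{iθ})
= -log tan (θ/2) + iπ/2` for `0 < θ ≤ π/2` (`logRatio_one`).

The missing power of the last entry comes from Euler polynomials: for odd `m`, pairing `E_{2j}(θ/π)`
with `sin mθ`, or `E_{2j+1}(θ/π)` with `cos mθ`, over `[0, π/2]` gives a constant times `m ^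
-(2j+1)`, or `m ^ -(2j+2)`. Taking `a = 2n` makes `f ^ (2n+1)` odd, so only odd `m` occur. Thus the
imaginary (real) part of `f(e^{iθ}) ^ (2n+1)` integrated against `E_{2j}` (`E_{2j+1}`) is a multiple
of the `T`-value, and the binomial theorem yields the stated sum.

Termwise integration is done at radius `r < 1`. As `r → 1`, the integrals converge by dominated
convergence (`exists_norm_logRatio_pow_le`), and the series converges because its terms are
nonnegative (`hasSum_of_tendsto_of_nonneg`). -/

theorem derivative_coeff_rescale_exp (p : ℕ) :
    derivative (PowerSeries.coeff (p + 1)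
      (2 * PowerSeries.rescale (X : ℚ[X]) (PowerSeries.exp ℚ[X]))) =
    PowerSeries.coeff p (2 * PowerSeries.rescale (X : ℚ[X]) (PowerSeries.exp ℚ[X])) := by
  have h2 : (2 : PowerSeries ℚ[X]) = PowerSeries.C (C (2 : ℚ)) := by
    rw [map_ofNat, map_ofNat]
  rw [h2, PowerSeries.coeff_C_mul, PowerSeries.coeff_C_mul, derivative_C_mul,
    PowerSeries.coeff_rescale, PowerSeries.coeff_rescale, PowerSeries.coeff_exp,
    PowerSeries.coeff_exp, algebraMap_eq, derivative_mul, derivative_C, derivative_X_pow]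
  have h : (C (1 / ((p + 1)! : ℚ)) : ℚ[X]) * C ((p + 1 : ℕ) : ℚ) = C (1 / (p ! : ℚ)) := by
    rw [← C_mul, Nat.factorial_succ]
    congr 1
    have := Nat.factorial_ne_zero p
    push_cast
    field_simp
  rw [← h]
  simp only [Nat.add_sub_cancel]
  ring

/-- Differentiating the generating function in `X` multiplies it by `Y`; only the exponential factor
depends on `X`. -/
theorem derivative_eulerPoly (j : ℕ) :
    derivative (eulerPoly (j + 1)) = ((j + 1 : ℕ) : ℚ[X]) * eulerPoly j := by
  unfold eulerPoly
  rw [PowerSeries.coeff_mul, PowerSeries.coeff_mul, Finset.Nat.antidiagonal_succ,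
    Finset.sum_cons, Finset.sum_map]
  simp only [Nat.factorial_succ, PowerSeries.coeff_map, derivative_mul, derivative_add,
    derivative_sum, derivative_natCast, derivative_C, mul_zero, zero_mul, zero_add, add_zero,
    Function.Embedding.prodMap, Function.Embedding.coeFn_mk, Prod.map,
    Function.Embedding.refl_apply, Nat.succ_eq_add_one, derivative_coeff_rescale_exp]
  have h0 : derivative (PowerSeries.coeff 0
      (2 * PowerSeries.rescale (X : ℚ[X]) (PowerSeries.exp ℚ[X]))) = 0 := by
    have h2 : (2 : PowerSeries ℚ[X]) = PowerSeries.C (C (2 : ℚ)) := by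
      rw [map_ofNat, map_ofNat]
    rw [h2, PowerSeries.coeff_C_mul]
    simp
  rw [h0]
  push_cast
  ring

theorem eval_eulerPoly (a : ℚ) (j : ℕ) :
    (eulerPoly j).eval a = (j ! : ℚ) * PowerSeries.coeff j
      (2 * PowerSeries.rescale a (PowerSeries.exp ℚ) * (PowerSeries.exp ℚ + 1)⁻¹) := by
  unfold eulerPoly
  rw [eval_mul, eval_natCast, ← coe_evalRingHom, ← PowerSeries.coeff_map]
  have h1 : PowerSeries.map (evalRingHom a)
      (PowerSeries.rescale (X : ℚ[X]) (PowerSeries.exp ℚ[X])) =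
      PowerSeries.rescale a (PowerSeries.exp ℚ) := by
    ext p
    simp [PowerSeries.coeff_rescale, PowerSeries.coeff_exp]
    exact mul_comm _ _
  have h2 (s : PowerSeries ℚ) :
      PowerSeries.map (evalRingHom a) (PowerSeries.map C s) = s := by
    ext p
    simp
  rw [RingHom.map_mul, RingHom.map_mul, h1, h2, map_ofNat]

theorem exp_add_one_inv_mul_cancel :
    (PowerSeries.exp ℚ + 1)⁻¹ * (PowerSeries.exp ℚ + 1) = 1 := by
  apply PowerSeries.inv_mul_cancel
  simp

theorem rescale_exp_mul_rescale_exp (a b : ℚ) :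
    PowerSeries.rescale a (PowerSeries.exp ℚ) * PowerSeries.rescale b (PowerSeries.exp ℚ) =
      PowerSeries.rescale (a + b) (PowerSeries.exp ℚ) :=
  PowerSeries.exp_mul_exp_eq_exp_add a b

theorem rescale_neg_one_exp_add_one_inv_mul_cancel :
    PowerSeries.rescale (-1) (PowerSeries.exp ℚ + 1)⁻¹ *
      (PowerSeries.rescale (-1) (PowerSeries.exp ℚ) + 1) = 1 := by
  have h := congrArg (PowerSeries.rescale (-1 : ℚ)) exp_add_one_inv_mul_cancel
  simpa only [map_mul, map_add, map_one] using h

/-- At `1/2` the generating function is `2e^{Y/2} / (e^Y + 1) = 1 / cosh (Y/2)`, an even series. -/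
theorem eval_half_eulerPoly_odd (j : ℕ) : (eulerPoly (2 * j + 1)).eval (1 / 2) = 0 := by
  set G := (PowerSeries.exp ℚ + 1)⁻¹ with hG
  set u := PowerSeries.rescale (1 / 2 : ℚ) (PowerSeries.exp ℚ) with hu
  set v := PowerSeries.rescale (-1 / 2 : ℚ) (PowerSeries.exp ℚ) with hv
  have huu : u * u = PowerSeries.exp ℚ := by
    rw [hu, rescale_exp_mul_rescale_exp]
    norm_num
  have hvv : v * v = PowerSeries.rescale (-1) (PowerSeries.exp ℚ) := by
    rw [hv, rescale_exp_mul_rescale_exp]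
    norm_num
  have huv : u * v = 1 := by
    rw [hv, hu, rescale_exp_mul_rescale_exp]
    norm_num
  have h1 := exp_add_one_inv_mul_cancel
  have h2 := rescale_neg_one_exp_add_one_inv_mul_cancel
  rw [← hG, ← huu] at h1
  rw [← hG, ← hvv] at h2
  have h3 : PowerSeries.rescale (-1) (2 * u * G) = 2 * u * G := by
    have : PowerSeries.rescale (-1) u = v := by
      rw [hu, hv, PowerSeries.rescale_rescale]
      norm_num
    rw [map_mul, map_mul, map_ofNat, this]
    linear_combination (2 * u * G) * h2 - 2 * v * (PowerSeries.rescale (-1) G) * h1 +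
      2 * (PowerSeries.rescale (-1) G) * G * (u - v) * huv
  have h4 := congrArg (PowerSeries.coeff (2 * j + 1)) h3
  rw [PowerSeries.coeff_rescale, pow_succ, pow_mul] at h4
  rw [eval_eulerPoly, ← hu, ← hG, mul_eq_zero]
  right
  norm_num at h4
  linarith

/-- `1 / (e^Y + 1) + 1 / (e^{-Y} + 1) = 1`, so the even coefficients of positive degree vanish. -/
theorem eval_zero_eulerPoly_even (j : ℕ) : (eulerPoly (2 * (j + 1))).eval 0 = 0 := by
  set G := (PowerSeries.exp ℚ + 1)⁻¹ with hG
  have huv : PowerSeries.exp ℚ * PowerSeries.rescale (-1) (PowerSeries.exp ℚ) = 1 := by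
    have := rescale_exp_mul_rescale_exp 1 (-1)
    norm_num at this
    exact this
  have h1 := exp_add_one_inv_mul_cancel
  have h2 := rescale_neg_one_exp_add_one_inv_mul_cancel
  rw [← hG] at h1 h2
  have h3 : PowerSeries.rescale (-1) G + G = 1 := by
    linear_combination
      (- PowerSeries.rescale (-1) G + 1) * h1 + (- G + G * (PowerSeries.exp ℚ + 1)) * h2 -
      PowerSeries.rescale (-1) G * G * huv
  have h4 := congrArg (PowerSeries.coeff (2 * (j + 1))) h3
  rw [map_add, PowerSeries.coeff_rescale, pow_mul, PowerSeries.coeff_one,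
    if_neg (by omega)] at h4
  norm_num at h4
  rw [eval_eulerPoly, ← hG]
  have h5 : (2 : PowerSeries ℚ) * PowerSeries.rescale 0 (PowerSeries.exp ℚ) =
      PowerSeries.C (2 : ℚ) := by
    rw [map_ofNat]
    simp
  rw [h5, PowerSeries.coeff_C_mul, mul_eq_zero]
  right
  linarith

theorem eulerPoly_zero : eulerPoly 0 = 1 := by
  have h : (PowerSeries.constantCoeff (2 : PowerSeries ℚ[X])) = C (2 : ℚ) := by
    rw [map_ofNat, map_ofNat]
  have h1 : PowerSeries.constantCoeff
      (PowerSeries.rescale (X : ℚ[X]) (PowerSeries.exp ℚ[X])) = 1 := by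
    rw [← PowerSeries.coeff_zero_eq_constantCoeff_apply, PowerSeries.coeff_rescale]
    simp
  have h2 : PowerSeries.constantCoeff
      (PowerSeries.map (C : ℚ →+* ℚ[X]) (PowerSeries.exp ℚ + 1)⁻¹) = C (1 / 2 : ℚ) := by
    rw [← PowerSeries.coeff_zero_eq_constantCoeff_apply, PowerSeries.coeff_map,
      PowerSeries.coeff_zero_eq_constantCoeff_apply, PowerSeries.constantCoeff_inv]
    norm_num
  rw [eulerPoly, PowerSeries.coeff_zero_eq_constantCoeff_apply, map_mul, map_mul, h, h1, h2,
    mul_one, ← C_mul]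
  norm_num

/-- The Euler polynomial `E_j(θ / π)` as a function of `θ`. -/
noncomputable def eulerFun (j : ℕ) (θ : ℝ) : ℝ := aeval (θ / Real.pi) (eulerPoly j)

theorem eulerFun_zero (θ : ℝ) : eulerFun 0 θ = 1 := by
  simp [eulerFun, eulerPoly_zero]

theorem eulerFun_even_apply_zero (j : ℕ) : eulerFun (2 * (j + 1)) 0 = 0 := by
  have := aeval_algebraMap_apply ℝ (0 : ℚ) (eulerPoly (2 * (j + 1)))
  rw [coe_aeval_eq_eval, eval_zero_eulerPoly_even] at this
  simpa [eulerFun] using this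

theorem eulerFun_odd_apply_pi_div_two (j : ℕ) : eulerFun (2 * j + 1) (Real.pi / 2) = 0 := by
  have := aeval_algebraMap_apply ℝ (1 / 2 : ℚ) (eulerPoly (2 * j + 1))
  rw [coe_aeval_eq_eval, eval_half_eulerPoly_odd] at this
  rw [eulerFun, show Real.pi / 2 / Real.pi = algebraMap ℚ ℝ (1 / 2) by
    have := Real.pi_ne_zero
    norm_num
    field_simp]
  simpa using this

theorem hasDerivAt_eulerFun (j : ℕ) (θ : ℝ) :
    HasDerivAt (eulerFun (j + 1)) ((j + 1 : ℕ) / Real.pi * eulerFun j θ) θ := by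
  have h := (Polynomial.hasDerivAt_aeval (eulerPoly (j + 1)) (θ / Real.pi)).comp θ
    ((hasDerivAt_id θ).div_const Real.pi)
  rw [derivative_eulerPoly, map_mul, map_natCast] at h
  exact h.congr_deriv (by rw [eulerFun]; ring)

theorem continuous_eulerFun (j : ℕ) : Continuous (eulerFun j) := by
  unfold eulerFun
  fun_prop

theorem cos_odd_mul_pi_div_two {m : ℕ} (hm : Odd m) : Real.cos (m * (Real.pi / 2)) = 0 := by
  obtain ⟨l, rfl⟩ := hm
  rw [Real.cos_eq_zero_iff]
  exact ⟨l, by push_cast; ring⟩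

/-- Integration by parts: the boundary term dies at `π/2` through the Euler polynomial and at `0`
through the sine. -/
theorem integral_eulerFun_odd_mul_cos (j : ℕ) {m : ℕ} (hm : Odd m) :
    ∫ θ in (0 : ℝ)..(Real.pi / 2), eulerFun (2 * j + 1) θ * Real.cos (m * θ) =
      -((2 * j + 1 : ℕ) / (Real.pi * m)) *
        ∫ θ in (0 : ℝ)..(Real.pi / 2), eulerFun (2 * j) θ * Real.sin (m * θ) := by
  have hm0 : (m : ℝ) ≠ 0 := by exact_mod_cast hm.pos.ne'
  have hd (θ : ℝ) : HasDerivAt (fun θ => Real.sin (m * θ) / m) (Real.cos (m * θ)) θ := by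
    have := (((hasDerivAt_id θ).const_mul (m : ℝ)).sin).div_const (m : ℝ)
    simpa [hm0] using this
  rw [intervalIntegral.integral_mul_deriv_eq_deriv_mul
    (fun θ _ => hasDerivAt_eulerFun (2 * j) θ) (fun θ _ => hd θ)
    (((continuous_eulerFun _).const_mul _).intervalIntegrable _ _)
    ((by fun_prop : Continuous fun θ : ℝ => Real.cos (m * θ)).intervalIntegrable _ _),
    eulerFun_odd_apply_pi_div_two, ← intervalIntegral.integral_const_mul]
  simp only [mul_zero, Real.sin_zero, zero_div, zero_mul, zero_sub, sub_zero,
    ← intervalIntegral.integral_neg]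
  congr 1
  funext θ
  field_simp

/-- Here the boundary term dies at `π/2` through the cosine, as `m` is odd, and at `0` through the
Euler polynomial. -/
theorem integral_eulerFun_even_succ_mul_sin (j : ℕ) {m : ℕ} (hm : Odd m) :
    ∫ θ in (0 : ℝ)..(Real.pi / 2), eulerFun (2 * (j + 1)) θ * Real.sin (m * θ) =
      ((2 * j + 2 : ℕ) / (Real.pi * m)) *
        ∫ θ in (0 : ℝ)..(Real.pi / 2), eulerFun (2 * j + 1) θ * Real.cos (m * θ) := by
  have hm0 : (m : ℝ) ≠ 0 := by exact_mod_cast hm.pos.ne'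
  have hd (θ : ℝ) : HasDerivAt (fun θ => -Real.cos (m * θ) / m) (Real.sin (m * θ)) θ := by
    have := (((hasDerivAt_id θ).const_mul (m : ℝ)).cos).neg.div_const (m : ℝ)
    simpa [hm0] using this
  rw [show 2 * (j + 1) = 2 * j + 1 + 1 by ring, intervalIntegral.integral_mul_deriv_eq_deriv_mul
    (fun θ _ => hasDerivAt_eulerFun (2 * j + 1) θ) (fun θ _ => hd θ)
    (((continuous_eulerFun _).const_mul _).intervalIntegrable _ _)
    ((by fun_prop : Continuous fun θ : ℝ => Real.sin (m * θ)).intervalIntegrable _ _),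
    cos_odd_mul_pi_div_two hm,
    show 2 * j + 1 + 1 = 2 * (j + 1) by ring, eulerFun_even_apply_zero, ← intervalIntegral.integral_const_mul]
  simp only [mul_zero, zero_div, zero_mul, zero_sub, sub_zero, neg_zero,
    ← intervalIntegral.integral_neg]
  congr 1
  funext θ
  field_simp

theorem integral_eulerFun_even_mul_sin (j : ℕ) {m : ℕ} (hm : Odd m) :
    ∫ θ in (0 : ℝ)..(Real.pi / 2), eulerFun (2 * j) θ * Real.sin (m * θ) =
      (-1) ^ j * (2 * j)! / (Real.pi ^ (2 * j) * m ^ (2 * j + 1)) := by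
  have hm0 : (m : ℝ) ≠ 0 := by exact_mod_cast hm.pos.ne'
  induction j with
  | zero =>
    simp [eulerFun_zero, intervalIntegral.integral_comp_mul_left, hm0,
      cos_odd_mul_pi_div_two hm]
  | succ j ih =>
    rw [integral_eulerFun_even_succ_mul_sin j hm, integral_eulerFun_odd_mul_cos j hm, ih,
      show 2 * (j + 1) = 2 * j + 1 + 1 by ring, Nat.factorial_succ, Nat.factorial_succ]
    have := Real.pi_ne_zero
    push_cast
    field_simp
    ring

theorem integral_eulerFun_odd_mul_cos' (j : ℕ) {m : ℕ} (hm : Odd m) :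
    ∫ θ in (0 : ℝ)..(Real.pi / 2), eulerFun (2 * j + 1) θ * Real.cos (m * θ) =
      (-1) ^ (j + 1) * (2 * j + 1)! / (Real.pi ^ (2 * j + 1) * m ^ (2 * j + 2)) := by
  have hm0 : (m : ℝ) ≠ 0 := by exact_mod_cast hm.pos.ne'
  rw [integral_eulerFun_odd_mul_cos j hm, integral_eulerFun_even_mul_sin j hm,
    Nat.factorial_succ]
  have := Real.pi_ne_zero
  push_cast
  field_simp
  ring

end EulerPolynomials
-- Reducing the multiple sum to a single series over the last entry.
section Combinatorics

open scoped ENNReal NNReal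

/-- Forgetting the largest entry. -/
def MultipleTIndex.init {n : ℕ} (x : MultipleTIndex (n + 1)) : MultipleTIndex n :=
  ⟨fun j => x.1 j.castSucc, fun _ _ h => x.2.1 (Fin.castSucc_lt_castSucc_iff.2 h),
    fun j => x.2.2 j.castSucc⟩

/-- The condition under which `m` can be appended to `x`. -/
def MultipleTIndex.Extends {n : ℕ} (x : MultipleTIndex n) (m : ℕ) : Prop :=
  (∀ j, x.1 j < m) ∧ 0 < m ∧ m ≡ n + 1 [MOD 2]

/-- Appending a largest entry. -/
def MultipleTIndex.snoc {n : ℕ} (x : MultipleTIndex n) (m : ℕ) (hm : x.Extends m) :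
    MultipleTIndex (n + 1) :=
  ⟨Fin.snoc (α := fun _ => ℕ) x.1 m, by
    constructor
    · intro i j
      refine Fin.lastCases ?_ (fun j => ?_) j
      · refine Fin.lastCases (fun h => absurd h (lt_irrefl _)) (fun i _ => ?_) i
        simpa using hm.1 i
      · refine Fin.lastCases (fun h => absurd h (Fin.castSucc_lt_last j).not_gt)
          (fun i h => ?_) i
        simpa using x.2.1 (Fin.castSucc_lt_castSucc_iff.1 h)
    · intro j
      refine Fin.lastCases ?_ (fun j => ?_) j
      · simpa using hm.2
      · simpa using x.2.2 j⟩

theorem MultipleTIndex.init_snoc {n : ℕ} (x : MultipleTIndex n) (m : ℕ) (hm : x.Extends m) :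
    (x.snoc m hm).init = x :=
  Subtype.ext (funext fun j => Fin.snoc_castSucc (α := fun _ => ℕ) m x.1 j)

theorem MultipleTIndex.snoc_last {n : ℕ} (x : MultipleTIndex n) (m : ℕ) (hm : x.Extends m) :
    (x.snoc m hm).1 (Fin.last n) = m :=
  Fin.snoc_last (α := fun _ => ℕ) m x.1

/-- An index of depth `n + 1` is one of depth `n` together with an admissible last entry. -/
def MultipleTIndex.snocEquiv (n : ℕ) :
    MultipleTIndex (n + 1) ≃ Σ x : MultipleTIndex n, {m : ℕ // x.Extends m} where
  toFun x := ⟨x.init, x.1 (Fin.last n), fun j => x.2.1 (Fin.castSucc_lt_last j), by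
    simpa using x.2.2 (Fin.last n)⟩
  invFun p := p.1.snoc p.2.1 p.2.2
  left_inv x := Subtype.ext (Fin.snoc_init_self (α := fun _ => ℕ) x.1)
  right_inv p := Sigma.subtype_ext (p.1.init_snoc p.2.1 p.2.2) (p.1.snoc_last p.2.1 p.2.2)

open Classical in
theorem tsum_multipleTIndex_succ {n : ℕ} (F : MultipleTIndex n → ℕ → ℝ≥0∞) :
    ∑' x : MultipleTIndex (n + 1), F x.init (x.1 (Fin.last n)) =
      ∑' x : MultipleTIndex n, ∑' m : ℕ, if x.Extends m then F x m else 0 := by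
  rw [← (MultipleTIndex.snocEquiv n).symm.tsum_eq, ENNReal.tsum_sigma']
  congr 1
  funext x
  have h : (fun m => if x.Extends m then F x m else 0) =
      Set.indicator {m | x.Extends m} (F x) := by
    funext m
    simp [Set.indicator_apply]
  rw [h, ← tsum_subtype]
  refine tsum_congr fun m => ?_
  change F (x.snoc m.1 m.2).init ((x.snoc m.1 m.2).1 (Fin.last n)) = _
  rw [x.init_snoc, x.snoc_last]

/-- The sum of `1 / (m₁ ⋯ mₐ)` over the indices of depth `a + 1` with last entry `m`. -/
noncomputable def innerSum : ℕ → ℕ → ℝ≥0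
  | 0, m => if m % 2 = 1 then 1 else 0
  | a + 1, m => if m % 2 = a % 2 then ∑ l ∈ Finset.range m, innerSum a l / l else 0

theorem innerSum_apply_zero (a : ℕ) : innerSum a 0 = 0 := by
  cases a <;> simp [innerSum]

theorem innerSum_eq_zero {a m : ℕ} (h : m % 2 ≠ (a + 1) % 2) : innerSum a m = 0 := by
  cases a with
  | zero => simpa [innerSum] using h
  | succ a => rw [innerSum, if_neg (by omega)]

/-- Induction for an arbitrary weight `g`: the sum over the last entry becomes part of the weight on
the preceding one. Values in `ℝ≥0∞` make the exchange of sums unconditional. -/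
theorem tsum_multipleTIndex_eq (a : ℕ) (g : ℕ → ℝ≥0∞) :
    ∑' x : MultipleTIndex (a + 1),
      (∏ j : Fin a, (x.1 j.castSucc : ℝ≥0∞)⁻¹) * g (x.1 (Fin.last a)) =
    ∑' m : ℕ, (innerSum a m : ℝ≥0∞) * g m := by
  classical
  induction a generalizing g with
  | zero =>
    have h := tsum_multipleTIndex_succ (n := 0) fun _ m => g m
    simp only [Finset.univ_eq_empty, Finset.prod_empty, one_mul]
    rw [h]
    have : Unique (MultipleTIndex 0) :=
      { default := ⟨fun j => j.elim0, fun i => i.elim0, fun i => i.elim0⟩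
        uniq := fun x => Subtype.ext (funext fun j => j.elim0) }
    rw [tsum_fintype, Fintype.sum_unique]
    refine tsum_congr fun m => ?_
    have : (default : MultipleTIndex 0).Extends m ↔ m % 2 = 1 := by
      simp only [MultipleTIndex.Extends, Nat.ModEq]
      refine ⟨fun h => by omega, fun h => ⟨fun j => j.elim0, by omega, by omega⟩⟩
    simp only [this, innerSum]
    split_ifs <;> simp
  | succ a ih =>
    have h := tsum_multipleTIndex_succ (n := a + 1)
      fun x m => (∏ j : Fin (a + 1), (x.1 j : ℝ≥0∞)⁻¹) * g m
    refine h.trans ?_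
    have h1 (x : MultipleTIndex (a + 1)) :
        (∑' m : ℕ, if x.Extends m then (∏ j : Fin (a + 1), (x.1 j : ℝ≥0∞)⁻¹) * g m else 0) =
        (∏ j : Fin a, (x.1 j.castSucc : ℝ≥0∞)⁻¹) *
          ((x.1 (Fin.last a) : ℝ≥0∞)⁻¹ *
            ∑' m : ℕ, if x.1 (Fin.last a) < m ∧ m % 2 = a % 2 then g m else 0) := by
      rw [← mul_assoc, ← Fin.prod_univ_castSucc fun j => (x.1 j : ℝ≥0∞)⁻¹,
        ← ENNReal.tsum_mul_left]
      refine tsum_congr fun m => ?_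
      have : x.Extends m ↔ x.1 (Fin.last a) < m ∧ m % 2 = a % 2 := by
        simp only [MultipleTIndex.Extends, Nat.ModEq]
        refine ⟨fun h => ⟨h.1 _, by omega⟩, fun h => ⟨fun j => ?_, by omega, by omega⟩⟩
        exact (x.2.1.monotone (Fin.le_last j)).trans_lt h.1
      simp only [this, mul_ite, mul_zero]
    rw [tsum_congr h1, ih fun l => (l : ℝ≥0∞)⁻¹ *
      ∑' m : ℕ, if l < m ∧ m % 2 = a % 2 then g m else 0]
    simp only [← ENNReal.tsum_mul_left]
    rw [ENNReal.tsum_comm]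
    refine tsum_congr fun m => ?_
    rw [innerSum]
    split_ifs with hm
    · rw [tsum_eq_sum (s := Finset.range m) (fun l hl => by simp_all),
        ENNReal.ofNNReal_finsetSum, Finset.sum_mul]
      refine Finset.sum_congr rfl fun l hl => ?_
      rw [if_pos ⟨Finset.mem_range.1 hl, hm⟩, ← mul_assoc]
      -- At `l = 0` the two conventions for inversion differ (`⊤` against `0`); the vanishing of
      -- `innerSum a 0` absorbs this.
      rcases Nat.eq_zero_or_pos l with rfl | hl0
      · simp [innerSum_apply_zero]
      · rw [ENNReal.coe_div (by positivity), div_eq_mul_inv]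
        simp
    · simp [hm]

theorem ofReal_multipleTTerm_onesThen (a b : ℕ) (x : MultipleTIndex (a + 1)) :
    ENNReal.ofReal (multipleTTerm (onesThen a b) x) =
      (∏ j : Fin a, (x.1 j.castSucc : ℝ≥0∞)⁻¹) * ((x.1 (Fin.last a) : ℝ≥0∞) ^ b)⁻¹ := by
  have hx (j : Fin (a + 1)) : (0 : ℝ) < x.1 j := by exact_mod_cast (x.2.2 j).1
  rw [multipleTTerm, Fin.prod_univ_castSucc]
  simp only [onesThen, Fin.snoc_castSucc, Fin.snoc_last, pow_one]
  rw [one_div, mul_inv, ENNReal.ofReal_mul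
    (inv_nonneg.2 (Finset.prod_nonneg fun j _ => (hx _).le)), ← Finset.prod_inv_distrib,
    ENNReal.ofReal_prod_of_nonneg fun j _ => (inv_pos.2 (hx _)).le]
  congr 1
  · refine Finset.prod_congr rfl fun j _ => ?_
    rw [ENNReal.ofReal_inv_of_pos (hx _), ENNReal.ofReal_natCast]
  · rw [ENNReal.ofReal_inv_of_pos (pow_pos (hx _) _), ENNReal.ofReal_pow (hx _).le,
      ENNReal.ofReal_natCast]

theorem hasSum_multipleTTerm_onesThen {a b : ℕ} {s : ℝ}
    (h : HasSum (fun m => (innerSum a m : ℝ) / m ^ b) s) :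
    HasSum (multipleTTerm (onesThen a b)) s := by
  have hnn (m : ℕ) : (0 : ℝ) ≤ innerSum a m / m ^ b := by positivity
  have hnn' (x : MultipleTIndex (a + 1)) : 0 ≤ multipleTTerm (onesThen a b) x := by
    unfold multipleTTerm
    positivity
  have h1 : ∑' x, ENNReal.ofReal (multipleTTerm (onesThen a b) x) = ENNReal.ofReal s := by
    rw [tsum_congr (ofReal_multipleTTerm_onesThen a b),
      tsum_multipleTIndex_eq a fun m => ((m : ℝ≥0∞) ^ b)⁻¹, ← h.tsum_eq,
      ENNReal.ofReal_tsum_of_nonneg hnn h.summable]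
    refine tsum_congr fun m => ?_
    rcases Nat.eq_zero_or_pos m with rfl | hm
    · simp [innerSum_apply_zero]
    · have hm' : (0 : ℝ) < m := by exact_mod_cast hm
      rw [ENNReal.ofReal_div_of_pos (by positivity), ENNReal.ofReal_pow hm'.le,
        ENNReal.ofReal_natCast, ENNReal.ofReal_coe_nnreal, div_eq_mul_inv]
  have hs : Summable (multipleTTerm (onesThen a b)) := by
    have := ENNReal.summable_toReal (h1.trans_ne ENNReal.ofReal_ne_top)
    simpa only [ENNReal.toReal_ofReal (hnn' _)] using this
  have h2 := ENNReal.ofReal_tsum_of_nonneg hnn' hs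
  rw [h1] at h2
  have h3 : ∑' x, multipleTTerm (onesThen a b) x = s := by
    rwa [ENNReal.ofReal_eq_ofReal_iff (tsum_nonneg hnn')
      (h.tsum_eq ▸ tsum_nonneg hnn)] at h2
  exact h3 ▸ hs.hasSum

end Combinatorics

/-! ### Powers of `log (1 + X) - log (1 - X)` as generating series. -/

section GeneratingSeries

open PowerSeries

/-- The power series `log (1 + X) - log (1 - X)`. -/
noncomputable def logRatioSeries : PowerSeries ℝ :=
  PowerSeries.mk fun m => (1 - (-1) ^ m) / m

theorem derivative_logRatioSeries :
    d⁄dX ℝ logRatioSeries = PowerSeries.mk fun m => 1 + (-1 : ℝ) ^ m := by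
  ext m
  rw [PowerSeries.coeff_derivative, logRatioSeries, coeff_mk, coeff_mk]
  have : (m : ℝ) + 1 ≠ 0 := by positivity
  push_cast
  field_simp
  ring

theorem coeff_logRatioSeries_pow_succ (a m : ℕ) :
    coeff (m + 1) (logRatioSeries ^ (a + 1)) * (m + 1) =
      (a + 1) * ∑ l ∈ Finset.range (m + 1),
        coeff l (logRatioSeries ^ a) * (1 + (-1) ^ (m - l)) := by
  rw [← PowerSeries.coeff_derivative, Derivation.leibniz_pow, derivative_logRatioSeries,
    Nat.add_sub_cancel, map_nsmul, smul_eq_mul, PowerSeries.coeff_mul,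
    Finset.Nat.sum_antidiagonal_eq_sum_range_succ_mk]
  simp

/-- The rule `(f ^ (a+2))' = (a+2) f ^ (a+1) f'` reproduces the recursion of `innerSum`. -/
theorem coeff_logRatioSeries_pow (a m : ℕ) :
    coeff m (logRatioSeries ^ (a + 1)) = (a + 1)! * 2 ^ (a + 1) * (innerSum a m / m) := by
  induction a generalizing m with
  | zero =>
    rw [zero_add, pow_one, logRatioSeries, coeff_mk, innerSum]
    split_ifs with h
    · rw [Odd.neg_one_pow (Nat.odd_iff.2 h)]
      norm_num
      ring
    · rw [Even.neg_one_pow (Nat.even_iff.2 (by omega))]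
      simp
  | succ a ih =>
    cases m with
    | zero => simp [logRatioSeries]
    | succ m =>
      have hm : (m : ℝ) + 1 ≠ 0 := by positivity
      rw [← mul_left_inj' hm, coeff_logRatioSeries_pow_succ, Finset.sum_congr rfl
        (g := fun l => if (m + 1) % 2 = a % 2 then
          (a + 1)! * 2 ^ (a + 2) * ((innerSum a l : ℝ) / l) else 0), innerSum]
      · split_ifs
        · rw [← Finset.mul_sum, Nat.factorial_succ (a + 1)]
          push_cast
          field_simp
        · simp
      · intro l hl
        have hl' : l ≤ m := by simpa [Nat.lt_succ_iff] using hl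
        rw [ih]
        -- Only this parity of `l` contributes; then `1 + (-1) ^ (m - l)` is `2` or `0` according to
        -- the parity of `m + 1`.
        by_cases h : l % 2 = (a + 1) % 2
        · split_ifs with h'
          · rw [Even.neg_one_pow (Nat.even_iff.2 (by omega))]
            ring
          · rw [Odd.neg_one_pow (Nat.odd_iff.2 (by omega))]
            ring
        · simp [innerSum_eq_zero h]

/-- Absolute convergence is carried along because the induction on `N` is by Cauchy products. -/
theorem hasSum_logRatioSeries_pow (N : ℕ) {z : ℂ} (hz : ‖z‖ < 1) :
    (Summable fun m => ‖((coeff m (logRatioSeries ^ N) : ℝ) : ℂ) * z ^ m‖) ∧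
      HasSum (fun m => ((coeff m (logRatioSeries ^ N) : ℝ) : ℂ) * z ^ m)
        ((Complex.log (1 + z) - Complex.log (1 - z)) ^ N) := by
  have h1 : (Summable fun m => ‖((coeff m logRatioSeries : ℝ) : ℂ) * z ^ m‖) ∧
      HasSum (fun m => ((coeff m logRatioSeries : ℝ) : ℂ) * z ^ m)
        (Complex.log (1 + z) - Complex.log (1 - z)) := by
    constructor
    · refine Summable.of_nonneg_of_le (fun _ => norm_nonneg _) (fun m => ?_)
        ((summable_geometric_of_lt_one (norm_nonneg z) hz).mul_left 2)
      rw [norm_mul, norm_pow, Complex.norm_real, logRatioSeries, coeff_mk]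
      gcongr
      rw [norm_div, RCLike.norm_natCast]
      have h2 : ‖(1 : ℝ) - (-1) ^ m‖ ≤ 2 := by
        rcases neg_one_pow_eq_or ℝ m with h | h <;> rw [h] <;> norm_num
      rcases Nat.eq_zero_or_pos m with rfl | hm
      · simp
      · exact (div_le_self (norm_nonneg _) (by exact_mod_cast hm)).trans h2
    · have h := (Complex.hasSum_taylorSeries_log hz).add (Complex.hasSum_taylorSeries_neg_log hz)
      rw [← sub_eq_add_neg] at h
      refine h.congr_fun fun m => ?_
      rw [logRatioSeries, coeff_mk]
      push_cast
      ring
  induction N with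
  | zero =>
    have : (fun m => ((coeff m (logRatioSeries ^ 0) : ℝ) : ℂ) * z ^ m) =
      fun m => if m = 0 then 1 else 0 := by
      funext m
      rw [pow_zero, coeff_one]
      split_ifs with h <;> simp [h]
    simp only [this]
    refine ⟨summable_of_ne_finset_zero (s := {0}) fun m hm => ?_, ?_⟩
    · simp_all
    · simpa using hasSum_ite_eq 0 (1 : ℂ)
  | succ N ih =>
    have h2 (m : ℕ) : ((coeff m (logRatioSeries ^ (N + 1)) : ℝ) : ℂ) * z ^ m =
        ∑ p ∈ Finset.HasAntidiagonal.antidiagonal m, (((coeff p.1 (logRatioSeries ^ N) : ℝ) : ℂ) * z ^ p.1) *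
          (((coeff p.2 logRatioSeries : ℝ) : ℂ) * z ^ p.2) := by
      rw [pow_succ, PowerSeries.coeff_mul, Complex.ofReal_sum, Finset.sum_mul]
      refine Finset.sum_congr rfl fun p hp => ?_
      rw [← Finset.HasAntidiagonal.mem_antidiagonal.1 hp, pow_add]
      push_cast
      ring
    have h3 := summable_norm_sum_mul_antidiagonal_of_summable_norm ih.1 h1.1
    simp only [← h2] at h3
    refine ⟨h3, ?_⟩
    have h4 := tsum_mul_tsum_eq_tsum_sum_antidiagonal_of_summable_norm ih.1 h1.1
    simp only [ih.2.tsum_eq, h1.2.tsum_eq, ← h2] at h4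
    rw [pow_succ (_ - _), h4]
    exact h3.of_norm.hasSum

end GeneratingSeries
-- A Tauberian theorem for nonnegative coefficients.
section Abel

open Filter Topology

/-- A Tauberian converse of Abel's theorem: for nonnegative coefficients, convergence of the
power series at `1` follows from the existence of the radial limit. -/
theorem hasSum_of_tendsto_of_nonneg {f : ℕ → ℝ} (hf : ∀ m, 0 ≤ f m) {G : ℝ → ℝ} {L : ℝ}
    (hG : ∀ r, 0 < r → r < 1 → HasSum (fun m => f m * r ^ m) (G r))
    (hL : Tendsto G (𝓝[<] 1) (𝓝 L)) : HasSum f L := by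
  have hev : ∀ᶠ r : ℝ in 𝓝[<] 1, 0 < r ∧ r < 1 := Ioo_mem_nhdsLT one_pos
  have hle (s : Finset ℕ) : ∑ m ∈ s, f m ≤ L := by
    have ht : Tendsto (fun r : ℝ => ∑ m ∈ s, f m * r ^ m) (𝓝[<] 1) (𝓝 (∑ m ∈ s, f m)) := by
      have hc : Continuous fun r : ℝ => ∑ m ∈ s, f m * r ^ m := by fun_prop
      simpa using (hc.tendsto 1).mono_left nhdsWithin_le_nhds
    refine le_of_tendsto_of_tendsto ht hL ?_
    filter_upwards [hev] with r hr
    exact sum_le_hasSum s (fun m _ => mul_nonneg (hf m) (pow_nonneg hr.1.le m))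
      (hG r hr.1 hr.2)
  have hs : Summable f := summable_of_sum_le hf hle
  have h1 : ∑' m, f m ≤ L := hs.tsum_le_of_sum_le hle
  have h2 : L ≤ ∑' m, f m := by
    refine le_of_tendsto hL ?_
    filter_upwards [hev] with r hr
    exact hasSum_le (fun m => mul_le_of_le_one_right (hf m) (pow_le_one₀ hr.1.le hr.2.le))
      (hG r hr.1 hr.2) hs.hasSum
  exact le_antisymm h1 h2 ▸ hs.hasSum

end Abel

/-! ### Boundary values of the logarithmic ratio and passage to the limit `r → 1`. -/

section LogRatio

open Complex Filter Topology MeasureTheory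

/-- The function `log (1 + z) - log (1 - z)` at `z = r e ^ (i θ)`. -/
noncomputable def logRatio (r θ : ℝ) : ℂ :=
  log (1 + r * exp (θ * I)) - log (1 - r * exp (θ * I))

theorem re_ofReal_mul_exp (r θ : ℝ) : (r * exp (θ * I)).re = r * Real.cos θ := by
  simp [exp_ofReal_mul_I_re]

theorem im_ofReal_mul_exp (r θ : ℝ) : (r * exp (θ * I)).im = r * Real.sin θ := by
  simp [exp_ofReal_mul_I_im]

theorem norm_ofReal_mul_exp {r : ℝ} (hr : 0 ≤ r) (θ : ℝ) : ‖(r * exp (θ * I) : ℂ)‖ = r := by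
  rw [norm_mul, norm_exp_ofReal_mul_I, mul_one, norm_real, Real.norm_of_nonneg hr]

theorem norm_log_le_abs_log_norm_add_pi (w : ℂ) : ‖log w‖ ≤ |Real.log ‖w‖| + Real.pi := by
  refine (norm_le_abs_re_add_abs_im _).trans ?_
  rw [log_re, log_im]
  gcongr
  exact abs_arg_le_pi w

theorem norm_logRatio_le {r θ : ℝ} (hr0 : 0 ≤ r) (hr1 : r ≤ 1) (hθ0 : 0 < θ)
    (hθ1 : θ ≤ Real.pi / 2) :
    ‖logRatio r θ‖ ≤ 2 * Real.pi + 2 + |Real.log (2 / Real.pi * θ)| := by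
  set z : ℂ := r * exp (θ * I) with hz
  have hzn : ‖z‖ = r := norm_ofReal_mul_exp hr0 θ
  have hcos : 0 ≤ Real.cos θ := Real.cos_nonneg_of_mem_Icc ⟨by linarith [Real.pi_pos], hθ1⟩
  have hlog2 : Real.log 2 ≤ 1 := by
    have := Real.log_two_lt_d9
    linarith
  have hx0 : 0 < 2 / Real.pi * θ := by
    have := Real.pi_pos
    positivity
  have hsin := Real.mul_le_sin hθ0.le hθ1
  have h1 : 1 ≤ ‖1 + z‖ := by
    refine le_trans ?_ (re_le_norm _)
    rw [add_re, one_re, re_ofReal_mul_exp]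
    nlinarith
  have h2 : ‖1 + z‖ ≤ 2 := (norm_add_le _ _).trans (by rw [norm_one, hzn]; linarith)
  have h3 : ‖1 - z‖ ≤ 2 := (norm_sub_le _ _).trans (by rw [norm_one, hzn]; linarith)
  have h4 : 2 / Real.pi * θ ≤ ‖1 - z‖ := by
    -- `‖1 - z‖² - sin² θ = (r - cos θ)²`, so the bound is uniform in `r`.
    refine hsin.trans (le_of_pow_le_pow_left₀ two_ne_zero (norm_nonneg _) ?_)
    rw [← normSq_eq_norm_sq, normSq_apply, sub_re, sub_im, one_re, one_im, re_ofReal_mul_exp,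
      im_ofReal_mul_exp]
    nlinarith [sq_nonneg (r - Real.cos θ), Real.sin_sq_add_cos_sq θ]
  have h5 : |Real.log ‖1 + z‖| ≤ 1 := by
    rw [abs_of_nonneg (Real.log_nonneg h1)]
    exact (Real.log_le_log (by linarith) h2).trans hlog2
  have h6 : |Real.log ‖1 - z‖| ≤ 1 + |Real.log (2 / Real.pi * θ)| := by
    have h7 := Real.log_le_log (hx0.trans_le h4) h3
    have h8 := Real.log_le_log hx0 h4
    have h9 := neg_abs_le (Real.log (2 / Real.pi * θ))
    have h10 := abs_nonneg (Real.log (2 / Real.pi * θ))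
    rw [abs_le]
    constructor <;> linarith
  have h11 := norm_log_le_abs_log_norm_add_pi (1 + z)
  have h12 := norm_log_le_abs_log_norm_add_pi (1 - z)
  have h13 : ‖logRatio r θ‖ ≤ ‖log (1 + z)‖ + ‖log (1 - z)‖ := norm_sub_le _ _
  linarith

/-- The singularity at `θ = 0` is logarithmic, so any power of it is dominated by the integrable `θ
^ (-1/2)`, uniformly in `r`. -/
theorem exists_norm_logRatio_pow_le (l : ℕ) : ∃ C : ℝ, ∀ r θ : ℝ, 0 ≤ r → r ≤ 1 → 0 < θ →
    θ ≤ Real.pi / 2 → ‖logRatio r θ‖ ^ l ≤ C * θ ^ (-(1 / 2) : ℝ) := by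
  -- Chosen so that `t * l ≤ 1/2`; the `+ 1` keeps `t` defined when `l = 0`.
  set t : ℝ := 1 / (2 * (l + 1)) with ht
  have ht0 : 0 < t := by positivity
  set K : ℝ := 2 * Real.pi + 2 + 1 / t with hK
  have hpi := Real.pi_pos
  refine ⟨K ^ l * (2 / Real.pi) ^ (-(1 / 2) : ℝ), fun r θ hr0 hr1 hθ0 hθ1 => ?_⟩
  set x := 2 / Real.pi * θ with hx
  have hx0 : 0 < x := by positivity
  have hx1 : x ≤ 1 := by
    rw [hx, div_mul_eq_mul_div, div_le_one hpi]
    linarith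
  have h1 : 1 ≤ x ^ (-t) := Real.one_le_rpow_of_pos_of_le_one_of_nonpos hx0 hx1 (by linarith)
  have h2 : |Real.log x| ≤ 1 / t * x ^ (-t) := by
    have := (Real.abs_log_mul_self_rpow_lt x t hx0 hx1 ht0).le
    rw [abs_mul, abs_of_nonneg (Real.rpow_nonneg hx0.le t)] at this
    rw [Real.rpow_neg hx0.le, ← div_eq_mul_inv]
    exact (le_div_iff₀ (Real.rpow_pos_of_pos hx0 t)).2 this
  have h3 : ‖logRatio r θ‖ ≤ K * x ^ (-t) := by
    refine (norm_logRatio_le hr0 hr1 hθ0 hθ1).trans ?_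
    rw [hK, add_mul]
    gcongr
    exact le_mul_of_one_le_right (by positivity) h1
  calc ‖logRatio r θ‖ ^ l ≤ (K * x ^ (-t)) ^ l := by gcongr
    _ = K ^ l * x ^ (-t * l) := by rw [mul_pow, Real.rpow_mul_natCast hx0.le]
    _ ≤ K ^ l * x ^ (-(1 / 2) : ℝ) := by
      refine mul_le_mul_of_nonneg_left
        (Real.rpow_le_rpow_of_exponent_ge hx0 hx1 ?_) (by positivity)
      rw [ht, neg_mul, neg_le_neg_iff, div_mul_eq_mul_div, one_mul,
        div_le_div_iff₀ (by positivity) (by positivity)]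
      linarith
    _ = K ^ l * (2 / Real.pi) ^ (-(1 / 2) : ℝ) * θ ^ (-(1 / 2) : ℝ) := by
      rw [hx, Real.mul_rpow (by positivity) hθ0.le, mul_assoc]

/-- With `θ = 2α`, `1 + e^{2iα} = 2 cos α e^{iα}` and `1 - e^{2iα} = 2 sin α e^{i(α - π/2)}`, both
with arguments in the principal range. -/
theorem logRatio_one {θ : ℝ} (hθ0 : 0 < θ) (hθ1 : θ ≤ Real.pi / 2) :
    logRatio 1 θ = -(Real.log (Real.tan (θ / 2)) : ℂ) + (Real.pi / 2 : ℝ) * I := by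
  have hpi := Real.pi_pos
  obtain ⟨α, rfl⟩ : ∃ α, θ = 2 * α := ⟨θ / 2, by ring⟩
  have hs : 0 < Real.sin α := Real.sin_pos_of_pos_of_lt_pi (by linarith) (by linarith)
  have hc : 0 < Real.cos α := Real.cos_pos_of_mem_Ioo ⟨by linarith, by linarith⟩
  have h1 : 1 + ((1 : ℝ) : ℂ) * exp ((2 * α : ℝ) * I) =
      ((2 * Real.cos α : ℝ) : ℂ) * exp (α * I) := by
    apply Complex.ext
    · rw [add_re, re_ofReal_mul_exp, re_ofReal_mul_exp, Real.cos_two_mul, one_re]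
      ring
    · rw [add_im, im_ofReal_mul_exp, im_ofReal_mul_exp, Real.sin_two_mul, one_im]
      ring
  have h2 : 1 - ((1 : ℝ) : ℂ) * exp ((2 * α : ℝ) * I) =
      ((2 * Real.sin α : ℝ) : ℂ) * exp ((α - Real.pi / 2 : ℝ) * I) := by
    apply Complex.ext
    · rw [sub_re, re_ofReal_mul_exp, re_ofReal_mul_exp, Real.cos_two_mul, one_re,
        Real.cos_sub_pi_div_two]
      linear_combination (-2) * Real.sin_sq_add_cos_sq α
    · rw [sub_im, im_ofReal_mul_exp, im_ofReal_mul_exp, Real.sin_two_mul, one_im,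
        Real.sin_sub_pi_div_two]
      ring
  have hlog (β : ℝ) (hβ0 : -Real.pi < β) (hβ1 : β ≤ Real.pi) : log (exp (β * I)) = β * I :=
    log_exp (by simpa using hβ0) (by simpa using hβ1)
  rw [logRatio, h1, h2, log_ofReal_mul (by positivity) (exp_ne_zero _),
    log_ofReal_mul (by positivity) (exp_ne_zero _), hlog α (by linarith) (by linarith),
    hlog _ (by linarith) (by linarith), mul_div_cancel_left₀ α two_ne_zero,
    Real.tan_eq_sin_div_cos, Real.log_div hs.ne' hc.ne', Real.log_mul two_ne_zero hs.ne',
    Real.log_mul two_ne_zero hc.ne']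
  push_cast
  ring

theorem continuous_logRatio {r : ℝ} (hr0 : 0 ≤ r) (hr1 : r < 1) : Continuous (logRatio r) := by
  have h (θ : ℝ) : |(r * exp (θ * I)).re| < 1 :=
    (abs_re_le_norm _).trans_lt (by rwa [norm_ofReal_mul_exp hr0])
  unfold logRatio
  refine Continuous.sub ?_ ?_
  · refine Continuous.clog (by fun_prop) fun θ => Or.inl ?_
    rw [add_re, one_re]
    linarith [neg_lt_of_abs_lt (h θ)]
  · refine Continuous.clog (by fun_prop) fun θ => Or.inl ?_
    rw [sub_re, one_re]
    linarith [lt_of_abs_lt (h θ)]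

theorem tendsto_logRatio {θ : ℝ} (hθ0 : 0 < θ) (hθ1 : θ ≤ Real.pi / 2) :
    Tendsto (fun r => logRatio r θ) (𝓝[<] 1) (𝓝 (logRatio 1 θ)) := by
  have hcos0 : 0 ≤ Real.cos θ := Real.cos_nonneg_of_mem_Icc ⟨by linarith [Real.pi_pos], hθ1⟩
  have hcos1 : Real.cos θ < 1 := by
    have := Real.cos_lt_cos_of_nonneg_of_le_pi_div_two le_rfl hθ1 hθ0
    rwa [Real.cos_zero] at this
  have h : ContinuousAt (fun r => logRatio r θ) 1 := by
    unfold logRatio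
    refine ContinuousAt.sub ?_ ?_
    · refine ContinuousAt.clog (by fun_prop) (Or.inl ?_)
      rw [add_re, one_re, re_ofReal_mul_exp]
      linarith
    · refine ContinuousAt.clog (by fun_prop) (Or.inl ?_)
      rw [sub_re, one_re, re_ofReal_mul_exp]
      linarith
  exact h.tendsto.mono_left nhdsWithin_le_nhds

/-- A general real-linear `ρ` treats real and imaginary parts at once. For `r < 1` the series
converges uniformly in `θ`. -/
theorem hasSum_integral_logRatio_pow (N : ℕ) (ρ : ℂ →L[ℝ] ℝ) {P : ℝ → ℝ} (hP : Continuous P)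
    {r : ℝ} (hr0 : 0 ≤ r) (hr1 : r < 1) (a b : ℝ) :
    HasSum (fun m : ℕ => (PowerSeries.coeff m (logRatioSeries ^ N) *
        ∫ θ in a..b, P θ * ρ (exp ((m * θ : ℝ) * I))) * r ^ m)
      (∫ θ in a..b, P θ * ρ (logRatio r θ ^ N)) := by
  have hz (θ : ℝ) : ‖(r * exp (θ * I) : ℂ)‖ < 1 := by rwa [norm_ofReal_mul_exp hr0]
  obtain ⟨c, hc⟩ : ∃ c : ℕ → ℝ, c = fun m =>
    PowerSeries.coeff m (logRatioSeries ^ N) * r ^ m := ⟨_, rfl⟩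
  have hterm (m : ℕ) (θ : ℝ) : ((PowerSeries.coeff m (logRatioSeries ^ N) : ℝ) : ℂ) *
      (r * exp (θ * I)) ^ m = c m • exp ((m * θ : ℝ) * I) := by
    rw [mul_pow, ← exp_nat_mul, real_smul, hc]
    push_cast
    ring_nf
  have hcs : Summable fun m => |c m| := by
    have := (hasSum_logRatioSeries_pow N (hz 0)).1
    simpa only [hterm, norm_smul, norm_exp_ofReal_mul_I, mul_one, Real.norm_eq_abs] using this
  have h := intervalIntegral.hasSum_integral_of_dominated_convergence (μ := volume)
    (a := a) (b := b)
    (F := fun m θ => c m * (P θ * ρ (exp ((m * θ : ℝ) * I))))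
    (f := fun θ => P θ * ρ (logRatio r θ ^ N))
    (fun m θ => |c m| * (|P θ| * ‖ρ‖)) (fun m => ?_) (fun m => ?_) ?_ ?_ ?_
  · refine h.congr_fun fun m => ?_
    rw [intervalIntegral.integral_const_mul, hc]
    ring
  · exact (by fun_prop : Continuous fun θ : ℝ =>
      c m * (P θ * ρ (exp ((m * θ : ℝ) * I)))).aestronglyMeasurable
  · refine Eventually.of_forall fun θ _ => ?_
    rw [norm_mul, norm_mul, Real.norm_eq_abs, Real.norm_eq_abs]
    gcongr
    refine (ρ.le_opNorm _).trans ?_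
    rw [norm_exp_ofReal_mul_I, mul_one]
  · exact Eventually.of_forall fun θ _ => hcs.mul_right _
  · simp only [tsum_mul_right]
    exact (by fun_prop : Continuous fun θ : ℝ =>
      (∑' m, |c m|) * (|P θ| * ‖ρ‖)).intervalIntegrable _ _
  · refine Eventually.of_forall fun θ _ => ?_
    have h1 := ρ.hasSum (hasSum_logRatioSeries_pow N (hz θ)).2
    have h2 := h1.mul_left (P θ)
    refine h2.congr_fun fun m => ?_
    simp only [hterm, map_smul, smul_eq_mul]
    ring

theorem tendsto_integral_logRatio_pow (N : ℕ) (ρ : ℂ →L[ℝ] ℝ) {P : ℝ → ℝ}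
    (hP : Continuous P) :
    Tendsto (fun r => ∫ θ in (0 : ℝ)..(Real.pi / 2), P θ * ρ (logRatio r θ ^ N)) (𝓝[<] 1)
      (𝓝 (∫ θ in (0 : ℝ)..(Real.pi / 2), P θ * ρ (logRatio 1 θ ^ N))) := by
  obtain ⟨C, hC⟩ := exists_norm_logRatio_pow_le N
  have hpi : 0 ≤ Real.pi / 2 := by linarith [Real.pi_pos]
  have hev : ∀ᶠ r : ℝ in 𝓝[<] 1, 0 < r ∧ r < 1 := Ioo_mem_nhdsLT one_pos
  refine intervalIntegral.tendsto_integral_filter_of_dominated_convergence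
    (fun θ => |P θ| * (‖ρ‖ * C) * θ ^ (-(1 / 2) : ℝ)) ?_ ?_ ?_ ?_
  · filter_upwards [hev] with r hr
    have := continuous_logRatio hr.1.le hr.2
    exact (by fun_prop : Continuous fun θ =>
      P θ * ρ (logRatio r θ ^ N)).aestronglyMeasurable
  · filter_upwards [hev] with r hr
    refine Eventually.of_forall fun θ hθ => ?_
    rw [Set.uIoc_of_le hpi] at hθ
    rw [norm_mul, Real.norm_eq_abs, mul_assoc, mul_assoc]
    gcongr
    refine (ρ.le_opNorm _).trans ?_
    gcongr
    rw [norm_pow]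
    exact hC r θ hr.1.le hr.2.le hθ.1 hθ.2
  · exact (intervalIntegral.intervalIntegrable_rpow' (by norm_num)).continuousOn_mul
      (by fun_prop)
  · refine Eventually.of_forall fun θ hθ => ?_
    rw [Set.uIoc_of_le hpi] at hθ
    exact ((ρ.continuous.tendsto _).comp ((tendsto_logRatio hθ.1 hθ.2).pow N)).const_mul _

theorem hasSum_coeff_mul_integral (N : ℕ) (ρ : ℂ →L[ℝ] ℝ) {P : ℝ → ℝ} (hP : Continuous P)
    (hnn : ∀ m : ℕ, 0 ≤ PowerSeries.coeff m (logRatioSeries ^ N) *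
      ∫ θ in (0 : ℝ)..(Real.pi / 2), P θ * ρ (exp ((m * θ : ℝ) * I))) :
    HasSum (fun m : ℕ => PowerSeries.coeff m (logRatioSeries ^ N) *
        ∫ θ in (0 : ℝ)..(Real.pi / 2), P θ * ρ (exp ((m * θ : ℝ) * I)))
      (∫ θ in (0 : ℝ)..(Real.pi / 2), P θ * ρ (logRatio 1 θ ^ N)) :=
  hasSum_of_tendsto_of_nonneg hnn
    (fun _ hr0 hr1 => hasSum_integral_logRatio_pow N ρ hP hr0.le hr1 _ _)
    (tendsto_integral_logRatio_pow N ρ hP)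

/-- `log tan (θ/2)` is minus the real part of `logRatio 1 θ`, so the same majorant applies. -/
theorem intervalIntegrable_eulerLogTan (j l : ℕ) :
    IntervalIntegrable (eulerLogTan j l) volume 0 (Real.pi / 2) := by
  obtain ⟨C, hC⟩ := exists_norm_logRatio_pow_le l
  have hpi : 0 ≤ Real.pi / 2 := by linarith [Real.pi_pos]
  have hb : IntervalIntegrable (fun θ : ℝ => C * θ ^ (-(1 / 2) : ℝ)) volume 0 (Real.pi / 2) :=
    (intervalIntegral.intervalIntegrable_rpow' (by norm_num)).const_mul C
  have h : IntervalIntegrable (fun θ => Real.log (Real.tan (θ / 2)) ^ l) volume 0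
      (Real.pi / 2) := by
    refine hb.mono_fun' ?_ ?_
    · have : Measurable fun θ : ℝ => Real.log (Real.tan (θ / 2)) ^ l := by
        simp only [Real.tan_eq_sin_div_cos]
        fun_prop
      exact this.aestronglyMeasurable
    · refine (ae_restrict_iff' measurableSet_uIoc).2 (Eventually.of_forall fun θ hθ => ?_)
      rw [Set.uIoc_of_le hpi] at hθ
      refine le_trans ?_ (hC 1 θ zero_le_one le_rfl hθ.1 hθ.2)
      simp only [norm_pow]
      gcongr
      have := abs_re_le_norm (logRatio 1 θ)
      rw [logRatio_one hθ.1 hθ.2] at this ⊢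
      simpa using this
  exact h.continuousOn_mul (continuous_eulerFun j).continuousOn

end LogRatio
-- Real and imaginary parts of odd powers.
section Expansion

open Complex

theorem sum_range_two_mul {M : Type*} [AddCommMonoid M] (f : ℕ → M) (n : ℕ) :
    ∑ i ∈ Finset.range (2 * n), f i = ∑ i ∈ Finset.range n, (f (2 * i) + f (2 * i + 1)) := by
  induction n with
  | zero => simp
  | succ n ih =>
    rw [Nat.mul_succ, Finset.sum_range_succ, Finset.sum_range_succ, ih, Finset.sum_range_succ,
      add_assoc]

theorem add_mul_I_pow_odd (x y : ℝ) (n : ℕ) :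
    ((x : ℂ) + y * I) ^ (2 * n + 1) =
      ((∑ m ∈ Finset.range (n + 1), (-1) ^ m * (2 * n + 1).choose (2 * m) *
          x ^ (2 * n + 1 - 2 * m) * y ^ (2 * m) : ℝ) : ℂ) +
      ((∑ m ∈ Finset.range (n + 1), (-1) ^ m * (2 * n + 1).choose (2 * m + 1) *
          x ^ (2 * n - 2 * m) * y ^ (2 * m + 1) : ℝ) : ℂ) * I := by
  rw [add_comm, add_pow, show 2 * n + 1 + 1 = 2 * (n + 1) by ring, sum_range_two_mul,
    ofReal_sum, ofReal_sum, Finset.sum_mul, ← Finset.sum_add_distrib]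
  refine Finset.sum_congr rfl fun m _ => ?_
  have hI : I ^ (2 * m) = (-1) ^ m := by rw [pow_mul, I_sq]
  rw [mul_pow, mul_pow, pow_succ I, hI, Nat.add_sub_add_right]
  push_cast
  ring

theorem re_logRatio_one_pow (n : ℕ) {θ : ℝ} (hθ0 : 0 < θ) (hθ1 : θ ≤ Real.pi / 2) :
    (logRatio 1 θ ^ (2 * n + 1)).re = ∑ m ∈ Finset.range (n + 1),
      (-1) ^ (m + 1) * (2 * n + 1).choose (2 * m) * (Real.pi / 2) ^ (2 * m) *
        Real.log (Real.tan (θ / 2)) ^ (2 * n + 1 - 2 * m) := by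
  rw [logRatio_one hθ0 hθ1, ← ofReal_neg, add_mul_I_pow_odd, add_re, ofReal_re, re_ofReal_mul,
    I_re, mul_zero, add_zero]
  refine Finset.sum_congr rfl fun m hm => ?_
  have hm' : m < n + 1 := Finset.mem_range.1 hm
  rw [Odd.neg_pow (n := 2 * n + 1 - 2 * m) ⟨n - m, by omega⟩]
  ring

theorem im_logRatio_one_pow (n : ℕ) {θ : ℝ} (hθ0 : 0 < θ) (hθ1 : θ ≤ Real.pi / 2) :
    (logRatio 1 θ ^ (2 * n + 1)).im = ∑ m ∈ Finset.range (n + 1),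
      (-1) ^ m * (2 * n + 1).choose (2 * m + 1) * (Real.pi / 2) ^ (2 * m + 1) *
        Real.log (Real.tan (θ / 2)) ^ (2 * n - 2 * m) := by
  rw [logRatio_one hθ0 hθ1, ← ofReal_neg, add_mul_I_pow_odd, add_im, ofReal_im, im_ofReal_mul,
    I_im, mul_one, zero_add]
  refine Finset.sum_congr rfl fun m hm => ?_
  have hm' : m < n + 1 := Finset.mem_range.1 hm
  rw [Even.neg_pow (n := 2 * n - 2 * m) ⟨n - m, by omega⟩]
  ring

end Expansion

/-! ### Assembling the two evaluations. -/

section MainTheorem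

open Complex MeasureTheory

/-- Integrating a finite sum of multiples of the functions `eulerLogTan`. -/
theorem integral_eulerFun_mul_sum {ρ : ℝ → ℝ} (j n : ℕ) (c : ℕ → ℝ) (l : ℕ → ℕ) (s : ℝ)
    (h : ∀ θ, 0 < θ → θ ≤ Real.pi / 2 → ρ θ = ∑ m ∈ Finset.range (n + 1),
      c m * Real.log (Real.tan (θ / 2)) ^ l m) :
    ∫ θ in (0 : ℝ)..(Real.pi / 2), s * eulerFun j θ * ρ θ =
      s * ∑ m ∈ Finset.range (n + 1),
        c m * ∫ θ in (0 : ℝ)..(Real.pi / 2), eulerLogTan j (l m) θ := by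
  have hpi : 0 ≤ Real.pi / 2 := by linarith [Real.pi_pos]
  simp only [← intervalIntegral.integral_const_mul]
  rw [← intervalIntegral.integral_finsetSum
    fun m _ => (intervalIntegrable_eulerLogTan j (l m)).const_mul (c m),
    ← intervalIntegral.integral_const_mul]
  refine intervalIntegral.integral_congr_ae (Filter.Eventually.of_forall fun θ hθ => ?_)
  rw [Set.uIoc_of_le hpi] at hθ
  rw [h θ hθ.1 hθ.2, mul_assoc, Finset.mul_sum]
  congr 1
  refine Finset.sum_congr rfl fun m _ => ?_
  rw [eulerLogTan, ← eulerFun]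
  ring

/-- The common part of the two evaluations: `ρ` is the real or the imaginary part. -/
theorem hasSum_multipleTTerm_of_integral (n b d : ℕ) (ρ : ℂ →L[ℝ] ℝ) {P : ℝ → ℝ}
    (hP : Continuous P) {κ : ℝ} (hκ : 0 < κ)
    (hint : ∀ m : ℕ, Odd m →
      ∫ θ in (0 : ℝ)..(Real.pi / 2), P θ * ρ (exp ((m * θ : ℝ) * I)) = κ / m ^ d)
    (hb : b = d + 1) :
    HasSum (multipleTTerm (onesThen (2 * n) b))
      ((∫ θ in (0 : ℝ)..(Real.pi / 2), P θ * ρ (logRatio 1 θ ^ (2 * n + 1))) /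
        ((2 * n + 1)! * 2 ^ (2 * n + 1) * κ)) := by
  have hf (m : ℕ) : PowerSeries.coeff m (logRatioSeries ^ (2 * n + 1)) *
      ∫ θ in (0 : ℝ)..(Real.pi / 2), P θ * ρ (exp ((m * θ : ℝ) * I)) =
      ((2 * n + 1)! * 2 ^ (2 * n + 1) * κ) * ((innerSum (2 * n) m : ℝ) / m ^ b) := by
    rw [coeff_logRatioSeries_pow]
    -- The moment is known only for odd `m`, but the coefficient vanishes for even `m`.
    by_cases hm : Odd m
    · have hm0 : (m : ℝ) ≠ 0 := by exact_mod_cast hm.pos.ne'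
      rw [hint m hm, hb, pow_succ (m : ℝ)]
      field_simp
    · have : innerSum (2 * n) m = 0 := innerSum_eq_zero (by
        rw [Nat.odd_iff] at hm
        omega)
      simp [this]
  have h := hasSum_coeff_mul_integral (2 * n + 1) ρ hP fun m => by
    rw [hf]
    positivity
  simp only [hf] at h
  apply hasSum_multipleTTerm_onesThen
  have hne : ((2 * n + 1)! * 2 ^ (2 * n + 1) * κ : ℝ) ≠ 0 := by positivity
  refine (h.div_const _).congr_fun fun m => ?_
  field_simp

theorem multipleT_onesThen_even (n j : ℕ) :
    Summable (multipleTTerm (onesThen (2 * n) (2 * j + 2))) ∧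
      multipleT (onesThen (2 * n) (2 * j + 2)) =
        Real.pi ^ (2 * j) / ((2 * j)! : ℝ) * ∑ m ∈ Finset.range (n + 1),
          (-1 : ℝ) ^ (j + m) * (Real.pi / 2) ^ (2 * m + 1) /
              (((2 * m + 1)! : ℝ) * ((2 * n - 2 * m)! : ℝ)) *
            ∫ θ in (0 : ℝ)..(Real.pi / 2), eulerLogTan (2 * j) (2 * n - 2 * m) θ := by
  have hpi := Real.pi_pos
  have h := hasSum_multipleTTerm_of_integral n (2 * j + 2) (2 * j + 1) imCLM
    -- The sign makes the moments positive, as the Tauberian step needs; it reappears in the final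
    -- formula.
    (P := fun θ => (-1) ^ j * eulerFun (2 * j) θ) ((continuous_eulerFun _).const_mul _)
    (κ := (2 * j)! / Real.pi ^ (2 * j)) (by positivity) (fun m hm => by
      simp only [imCLM_apply, exp_ofReal_mul_I_im, mul_assoc]
      rw [intervalIntegral.integral_const_mul, integral_eulerFun_even_mul_sin j hm,
        mul_div_assoc, ← mul_assoc, ← mul_pow]
      norm_num
      field_simp) rfl
  refine ⟨h.summable, ?_⟩
  rw [multipleT, h.tsum_eq]
  simp only [imCLM_apply]
  rw [integral_eulerFun_mul_sum (2 * j) n _ _ _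
    fun θ h0 h1 => im_logRatio_one_pow n h0 h1, Finset.mul_sum, Finset.sum_div,
    Finset.mul_sum, Finset.mul_sum]
  refine Finset.sum_congr rfl fun m hm => ?_
  have hm' : m < n + 1 := Finset.mem_range.1 hm
  -- The binomial coefficient over `(2n+1)!` leaves the two factorials in the denominator.
  rw [Nat.cast_choose ℝ (by omega : 2 * m + 1 ≤ 2 * n + 1), Nat.add_sub_add_right, pow_add (-1 : ℝ) j m]
  field_simp

theorem multipleT_onesThen_odd (n j : ℕ) :
    Summable (multipleTTerm (onesThen (2 * n) (2 * j + 3))) ∧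
      multipleT (onesThen (2 * n) (2 * j + 3)) =
        Real.pi ^ (2 * j + 1) / ((2 * j + 1)! : ℝ) * ∑ m ∈ Finset.range (n + 1),
          (-1 : ℝ) ^ (j + m) * (Real.pi / 2) ^ (2 * m) /
              (((2 * m)! : ℝ) * ((2 * n + 1 - 2 * m)! : ℝ)) *
            ∫ θ in (0 : ℝ)..(Real.pi / 2), eulerLogTan (2 * j + 1) (2 * n + 1 - 2 * m) θ := by
  have hpi := Real.pi_pos
  have h := hasSum_multipleTTerm_of_integral n (2 * j + 3) (2 * j + 2) reCLM
    (P := fun θ => (-1) ^ (j + 1) * eulerFun (2 * j + 1) θ)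
    ((continuous_eulerFun _).const_mul _)
    (κ := (2 * j + 1)! / Real.pi ^ (2 * j + 1)) (by positivity) (fun m hm => by
      simp only [reCLM_apply, exp_ofReal_mul_I_re, mul_assoc]
      rw [intervalIntegral.integral_const_mul, integral_eulerFun_odd_mul_cos' j hm,
        mul_div_assoc, ← mul_assoc, ← mul_pow]
      norm_num
      field_simp) rfl
  refine ⟨h.summable, ?_⟩
  rw [multipleT, h.tsum_eq]
  simp only [reCLM_apply]
  rw [integral_eulerFun_mul_sum (2 * j + 1) n _ _ _
    fun θ h0 h1 => re_logRatio_one_pow n h0 h1, Finset.mul_sum, Finset.sum_div,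
    Finset.mul_sum, Finset.mul_sum]
  refine Finset.sum_congr rfl fun m hm => ?_
  have hm' : m < n + 1 := Finset.mem_range.1 hm
  -- The extra sign in `P` cancels the one from the odd power of `-log tan (θ/2)`.
  rw [Nat.cast_choose ℝ (by omega : 2 * m ≤ 2 * n + 1), pow_add (-1 : ℝ) j m, pow_succ (-1 : ℝ) j,
    pow_succ (-1 : ℝ) m]
  field_simp

end MainTheorem

theorem mainTheorem7 (n k : ℕ) (hk : 1 ≤ k) :
    (Summable (multipleTTerm (onesThen (2 * n) (2 * k))) ∧
      (∀ m ∈ Finset.range (n + 1), IntervalIntegrable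
        (eulerLogTan (2 * k - 2) (2 * n - 2 * m)) MeasureTheory.volume 0 (Real.pi / 2)) ∧
      multipleT (onesThen (2 * n) (2 * k)) =
        Real.pi ^ (2 * k - 2) / ((2 * k - 2)! : ℝ) *
          ∑ m ∈ Finset.range (n + 1),
            (-1 : ℝ) ^ (k + m - 1) * (Real.pi / 2) ^ (2 * m + 1) /
                (((2 * m + 1)! : ℝ) * ((2 * n - 2 * m)! : ℝ)) *
              ∫ θ in (0 : ℝ)..(Real.pi / 2), eulerLogTan (2 * k - 2) (2 * n - 2 * m) θ) ∧
    (Summable (multipleTTerm (onesThen (2 * n) (2 * k + 1))) ∧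
      (∀ m ∈ Finset.range (n + 1), IntervalIntegrable
        (eulerLogTan (2 * k - 1) (2 * n + 1 - 2 * m)) MeasureTheory.volume 0 (Real.pi / 2)) ∧
      multipleT (onesThen (2 * n) (2 * k + 1)) =
        Real.pi ^ (2 * k - 1) / ((2 * k - 1)! : ℝ) *
          ∑ m ∈ Finset.range (n + 1),
            (-1 : ℝ) ^ (k + m - 1) * (Real.pi / 2) ^ (2 * m) /
                (((2 * m)! : ℝ) * ((2 * n + 1 - 2 * m)! : ℝ)) *
              ∫ θ in (0 : ℝ)..(Real.pi / 2),
                eulerLogTan (2 * k - 1) (2 * n + 1 - 2 * m) θ) := by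
  obtain ⟨j, rfl⟩ : ∃ j, k = j + 1 := ⟨k - 1, by omega⟩
  have hsign (m : ℕ) : j + 1 + m - 1 = j + m := by omega
  have h1 := multipleT_onesThen_even n j
  have h2 := multipleT_onesThen_odd n j
  simp only [hsign, show 2 * (j + 1) = 2 * j + 2 by ring]
  exact ⟨⟨h1.1, fun m _ => intervalIntegrable_eulerLogTan _ _, h1.2⟩,
    h2.1, fun m _ => intervalIntegrable_eulerLogTan _ _, h2.2⟩
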